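/- Let $d_D,d_{\mathcal T}\ge 1$, let $D\subset\mathbb R^{d_D}$ and $\mathcal T\subset\mathbb R^{d_{\mathcal T}}$ be compact and convex, let $\lambda$ be Lebesgue measure, and assume $\lambda(\mathcal T)>0$. Let $Z=(Z_{x,t})_{(x,t)\in D\times\mathcal T}$ be a centred Gaussian process on a probability space $(\Omega,\mathcal F,P)$ that is measurable (i.e. $(x,t,\omega)\mapsto Z_{x,t}(\omega)$ is jointly measurable) and separable, i.e. there are a countable dense set $S_0\subset D\times\mathcal T$ and a null event $N\in\mathcal F$ such that, for every relatively open $E\subset D\times\mathcal T$ and every closed $B\subset\mathbb R$, the sets $\{\omega: Z_s(\omega)\in B\ \forall s\in E\}$ and $\{\omega: Z_s(\omega)\in B\ \forall s\in E\cap S_0\}$ differ only by a subset of $N$. Let $k$ be the covariance kernel of $Z$ and suppose that there are constants $C,\alpha_1,\alpha_2>0$ such that for all $x,x'\in D$ and $t,t'\in\mathcal T$ $$k([x,t],[x,t])+k([x',t'],[x',t'])-2k([x,t],[x',t'])\le C\max\left(\|x-x'\|_\infty^{\alpha_1},\|t-t'\|_\infty^{\alpha_2}\right).$$ Let $Y$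 be the spatial logistic Gaussian process (SLGP) induced by $Z$, $$Y_{x,t}=\frac{e^{Z_{x,t}}}{\int_{\mathcal T}e^{Z_{x,u}}\,d\lambda(u)},\qquad (x,t)\in D\times\mathcal T .$$ Then: 1. Almost surely, for all $x\in D$ one has $\int_{\mathcal T}e^{Z_{x,u}}\,d\lambda(u)<\infty$ and $Y_{x,\cdot}$ is a positive probability density function on $\mathcal T$ with respect to $\lambda$. 2. Almost surely, for every $\beta$ with $0<\beta<\alpha_1/2$, the map $x\mapsto Y_{x,\cdot}$ is $\beta$-Hölder continuous with respect to the sup norm: there is a finite (random) constant $K$ such that $\sup_{t\in\mathcal T}|Y_{x,t}-Y_{x',t}|\le K\,\|x-x'\|_\infty^{\beta}$ for all $x,x'\in D$. -/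

import Mathlib

open MeasureTheory ProbabilityTheory
open scoped NNReal ENNReal symmDiff

namespace SLGP

/-- A random field `Z` indexed by a topological space `S` is separable if there are a countable
dense `S₀ ⊆ S` and a null event `N` such that, for every open `E ⊆ S` and closed `B ⊆ ℝ`, the sets
`{ω | Z_s(ω) ∈ B for all s ∈ E}` and `{ω | Z_s(ω) ∈ B for all s ∈ E ∩ S₀}` differ only inside
`N`. -/
def IsSeparableField {S Ω : Type*} [TopologicalSpace S] [MeasurableSpace Ω]
    (P : Measure Ω) (Z : S → Ω → ℝ) : Prop :=
  ∃ S₀ : Set S, S₀.Countable ∧ Dense S₀ ∧ ∃ N : Set Ω, MeasurableSet N ∧ P N = 0 ∧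
    ∀ E : Set S, IsOpen E → ∀ B : Set ℝ, IsClosed B →
      {ω | ∀ s ∈ E, Z s ω ∈ B} ∆ {ω | ∀ s ∈ E ∩ S₀, Z s ω ∈ B} ⊆ N

/-- A random field is measurable if it is jointly measurable in the index and in `ω`. -/
def IsMeasurableField {S Ω : Type*} [MeasurableSpace S] [MeasurableSpace Ω]
    (Z : S → Ω → ℝ) : Prop :=
  Measurable fun p : S × Ω => Z p.1 p.2

/-- A random field is centred if all its means vanish. -/
def IsCentredField {S Ω : Type*} [MeasurableSpace Ω] (P : Measure Ω) (Z : S → Ω → ℝ) : Prop :=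
  ∀ s, ∫ ω, Z s ω ∂P = 0

/-- The covariance kernel of a random field. -/
noncomputable def covKernel {S Ω : Type*} [MeasurableSpace Ω] (P : Measure Ω) (Z : S → Ω → ℝ)
    (s s' : S) : ℝ :=
  cov[Z s, Z s'; P]

/-- The square of the canonical semi-distance associated with a kernel. -/
def canonicalSqDist {S : Type*} (k : S → S → ℝ) (s s' : S) : ℝ :=
  k s s + k s' s' - 2 * k s s'

/-- The Hölder-type condition on a kernel on `D × T`, with constants `C`, `α₁`, `α₂`. The norm of
`Fin d → ℝ` is the sup norm. -/
def KernelHolderCondition {dD dT : ℕ} {D : Set (Fin dD → ℝ)} {T : Set (Fin dT → ℝ)}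
    (k : D × T → D × T → ℝ) (C α₁ α₂ : ℝ) : Prop :=
  ∀ (x x' : D) (t t' : T),
    canonicalSqDist k (x, t) (x', t') ≤
      C * max (‖(x : Fin dD → ℝ) - x'‖ ^ α₁) (‖(t : Fin dT → ℝ) - t'‖ ^ α₂)

/-- Lebesgue measure on a (measurable) subset `T` of `ℝ^d`, as a measure on the subtype. -/
noncomputable def lebesgueOn {d : ℕ} (T : Set (Fin d → ℝ)) : Measure T :=
  Measure.comap (fun t : T => (t : Fin d → ℝ)) volume

/-- The spatial logistic density transformation
`(x, t) ↦ exp (f (x, t)) / ∫_T exp (f (x, u)) dλ(u)`. -/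
noncomputable def spatialLogistic {X : Type*} {dT : ℕ} {T : Set (Fin dT → ℝ)}
    (f : X × T → ℝ) (x : X) (t : T) : ℝ :=
  Real.exp (f (x, t)) / ∫ u, Real.exp (f (x, u)) ∂(lebesgueOn T)

/-- The spatial logistic process induced by a random field `Z`, as a random field of functions:
`inducedSLGP Z ω x t` is `Y_{x,t}(ω)`. -/
noncomputable def inducedSLGP {Ω X : Type*} {dT : ℕ} {T : Set (Fin dT → ℝ)}
    (Z : X × T → Ω → ℝ) (ω : Ω) : X → T → ℝ :=
  spatialLogistic fun s => Z s ω

/-- A probability density function on `T` with respect to Lebesgue measure that is (everywhere)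
positive. -/
structure IsPositivePdf {dT : ℕ} {T : Set (Fin dT → ℝ)} (f : T → ℝ) : Prop where
  measurable : Measurable f
  pos : ∀ t, 0 < f t
  lintegral_eq_one : ∫⁻ t, ENNReal.ofReal (f t) ∂(lebesgueOn T) = 1

end SLGP

/-!
# Sample path regularity of the spatial logistic Gaussian process

The statement reduces to a modulus of continuity for the Gaussian field `Z` itself. Measure
closeness in `D × T` at scale `n` by `‖x - x'‖ ≤ R₁ * r₁ ^ n` and `‖t - t'‖ ≤ R₂ * r₂ ^ n`, with
`r₁ ^ α₁ = r₂ ^ α₂ = 1 / 4`. The kernel condition then says that increments of `Z` at scale `n` have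
standard deviation `O(2 ^ (-n))`, so, `Z` being Gaussian, `p`-th moments `O(2 ^ (-n * p))` for every
`p` (`exists_lintegral_enorm_increment_pow_le`). As `D × T` has nets at scale `n` of size geometric
in `n` (`exists_nets`), taking `p` large shows that all increments between neighbouring net points
are almost surely `O(q ^ n)`, for any `q > 1 / 2` (`ae_exists_forall_abs_le_mul_pow`). Chaining and
separability extend this to all pairs of points at scale `n` (`ae_exists_modulus`). Working with the
two-parameter scales rather than with a metric treats all exponents `α₁, α₂ > 0` alike, including
those above `2`.

Since scale `0` contains all pairs, the sample paths are bounded. This gives the integrability of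
`exp Z` and positivity of the normalising integral; measurability of the sections comes from joint
measurability. On bounded functions `g ↦ exp g / ∫ exp g` is Lipschitz for the sup norm
(`abs_exp_div_integral_sub_le`), so `Y` inherits the modulus of `Z` in `x`, uniformly in `t`. Finally
`r₁ ^ (α₁ / 2) = 1 / 2`, so for `β < α₁ / 2` there is a rational `q` with `1 / 2 < q < r₁ ^ β`, and
`q ^ n ≤ (r₁ ^ n) ^ β` is a Hölder bound with exponent `β`. Only countably many `q` are needed, hence
a single null set serves all `β`.
-/

namespace SLGP

open Set Filter Topology

/-! ### Nets of a bounded set -/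

/-- A bounded subset of `ℝ^d` has, at every scale `R * r ^ n`, a finite net whose size grows at most
geometrically in `n`. The net is the range of `π n`, which picks one point of `D` in each nonempty
cell of the cubic grid of mesh `R * r ^ n`. -/
theorem exists_nets {d : ℕ} {D : Set (Fin d → ℝ)} (hD : Bornology.IsBounded D) {r : ℝ}
    (hr : 0 < r) :
    ∃ R : ℝ, 0 < R ∧ (∀ x y : D, ‖(x : Fin d → ℝ) - y‖ ≤ R) ∧
      ∃ (A M : ℕ) (π : ℕ → D → D), ∀ n,
        (∀ x : D, ‖(x : Fin d → ℝ) - π n x‖ ≤ R * r ^ n) ∧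
        (range (π n)).Finite ∧ (range (π n)).ncard ≤ A * M ^ n := by
  obtain ⟨R₀, hR₀, hDR⟩ := hD.exists_pos_norm_le
  obtain ⟨N, hN⟩ := exists_nat_ge (1 / r)
  have hN1 : 1 ≤ N * r := by rwa [div_le_iff₀ hr] at hN
  have hN0 : 1 ≤ N := by
    rcases Nat.eq_zero_or_pos N with h | h
    · simp [h] at hN1
      linarith
    · exact h
  refine ⟨2 * R₀, by positivity, fun x y => ?_, 3 ^ d, N ^ d, ?_⟩
  · have := norm_sub_le (x : Fin d → ℝ) y
    linarith [hDR x x.2, hDR y y.2]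
  let cell : ℕ → D → (Fin d → ℤ) := fun n x i => ⌊(x : Fin d → ℝ) i / (2 * R₀ * r ^ n)⌋
  have hcell : ∀ n (x : D), cell n x ∈ Fintype.piFinset fun _ : Fin d =>
      Finset.Icc (-(N : ℤ) ^ n) ((N : ℤ) ^ n) := by
    intro n x
    rw [Fintype.mem_piFinset]
    intro i
    have hrn : 0 < 2 * R₀ * r ^ n := by positivity
    have hxi : |(x : Fin d → ℝ) i| ≤ R₀ := (norm_le_pi_norm (x : Fin d → ℝ) i).trans (hDR x x.2)
    have hNr : 1 ≤ (N : ℝ) ^ n * r ^ n := by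
      rw [← mul_pow]
      exact one_le_pow₀ hN1
    have hbd : R₀ ≤ (N : ℝ) ^ n * (2 * R₀ * r ^ n) := by nlinarith
    rw [abs_le] at hxi
    rw [Finset.mem_Icc]
    constructor
    · rw [Int.le_floor, le_div_iff₀ hrn]
      push_cast
      linarith
    · have : (⌊(x : Fin d → ℝ) i / (2 * R₀ * r ^ n)⌋ : ℝ) ≤ (N : ℝ) ^ n := by
        refine (Int.floor_le _).trans ?_
        rw [div_le_iff₀ hrn]
        linarith
      exact_mod_cast this
  refine ⟨fun n x => rangeSplitting (cell n) ⟨cell n x, mem_range_self x⟩, fun n => ⟨?_, ?_⟩⟩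
  · intro x
    set y := rangeSplitting (cell n) ⟨cell n x, mem_range_self x⟩ with hy
    have hxy : cell n y = cell n x := apply_rangeSplitting (cell n) _
    have hrn : 0 < 2 * R₀ * r ^ n := by positivity
    rw [pi_norm_le_iff_of_nonneg hrn.le]
    intro i
    have h1 := Int.abs_sub_lt_one_of_floor_eq_floor (congrFun hxy i).symm
    rw [← sub_div, abs_div, abs_of_pos hrn, div_lt_one hrn] at h1
    exact h1.le
  · have hsub : range (fun x => rangeSplitting (cell n) ⟨cell n x, mem_range_self x⟩) ⊆
        range (rangeSplitting (cell n)) := by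
      rintro _ ⟨x, rfl⟩
      exact mem_range_self _
    have hcr : range (cell n) ⊆ (Fintype.piFinset fun _ : Fin d =>
        Finset.Icc (-(N : ℤ) ^ n) ((N : ℤ) ^ n) : Finset (Fin d → ℤ)) := by
      rintro _ ⟨x, rfl⟩
      exact hcell n x
    have hcf : (range (cell n)).Finite := (Finset.finite_toSet _).subset hcr
    have : Finite (range (cell n)) := hcf
    have hfin := finite_range (rangeSplitting (cell n))
    refine ⟨hfin.subset hsub, (ncard_le_ncard hsub hfin).trans ?_⟩
    calc (range (rangeSplitting (cell n))).ncard
        ≤ Nat.card (range (cell n)) := by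
          rw [← image_univ, ← ncard_univ]
          exact ncard_image_le
      _ ≤ ((N : ℤ) ^ n + 1 - -(N : ℤ) ^ n).toNat ^ d := by
          have := ncard_le_ncard hcr (Finset.finite_toSet _)
          rw [ncard_coe_finset, Fintype.card_piFinset_const, Int.card_Icc] at this
          exact this
      _ ≤ (3 * N ^ n) ^ d := by
          refine Nat.pow_le_pow_left ?_ d
          have h1 : 1 ≤ N ^ n := Nat.one_le_pow _ _ hN0
          zify at h1
          have : ((N : ℤ) ^ n + 1 - -(N : ℤ) ^ n) ≤ ((3 * N ^ n : ℕ) : ℤ) := by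
            push_cast
            linarith
          omega
      _ = 3 ^ d * (N ^ d) ^ n := by rw [mul_pow, ← pow_mul, ← pow_mul, mul_comm n]

/-! ### From moments to almost sure bounds -/

variable {Ω : Type*} [MeasurableSpace Ω] {P : Measure Ω}

/-- If geometrically many random variables at level `n` have `p`-th moments of order `2 ^ (-n * p)`
for every `p`, then almost surely they are all `O(q ^ n)`, for any `q > 1 / 2`: for `p` large the
sum of the `p`-th moments of the variables divided by `q ^ n` converges. -/
theorem ae_exists_forall_abs_le_mul_pow {ι : Type*} {X : ι → Ω → ℝ} (hX : ∀ i, Measurable (X i))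
    {I : ℕ → Set ι} (hfin : ∀ n, (I n).Finite) {A M : ℕ} (hcard : ∀ n, (I n).ncard ≤ A * M ^ n)
    (hmom : ∀ p : ℕ, ∃ c : ℝ≥0, ∀ n, ∀ i ∈ I n,
      ∫⁻ ω, ‖X i ω‖ₑ ^ p ∂P ≤ c * (((2⁻¹ : ℝ≥0) ^ n) ^ p : ℝ≥0))
    {q : ℝ≥0} (hq : 2⁻¹ < q) :
    ∀ᵐ ω ∂P, ∃ K : ℝ, 0 ≤ K ∧ ∀ n, ∀ i ∈ I n, |X i ω| ≤ K * q ^ n := by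
  have hq0 : 0 < q := lt_trans (by positivity) hq
  have hlt : 2⁻¹ * q⁻¹ < (1 : ℝ≥0) := by
    rw [← div_eq_mul_inv, div_lt_one hq0]
    exact hq
  obtain ⟨p, hp1, hp⟩ : ∃ p : ℕ, 1 ≤ p ∧ M * (2⁻¹ * q⁻¹) ^ p < (1 : ℝ≥0) := by
    have h : Tendsto (fun p : ℕ => (M : ℝ≥0) * (2⁻¹ * q⁻¹) ^ p) atTop (𝓝 (M * 0)) :=
      (NNReal.tendsto_pow_atTop_nhds_zero_of_lt_one hlt).const_mul _
    rw [mul_zero] at h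
    obtain ⟨p, h1, h2⟩ := ((eventually_ge_atTop 1).and (h.eventually (gt_mem_nhds one_pos))).exists
    exact ⟨p, h1, h2⟩
  obtain ⟨c, hc⟩ := hmom p
  let f : Ω → ℝ≥0∞ := fun ω =>
    ∑' n, ∑ i ∈ (hfin n).toFinset, (((q⁻¹ ^ n) ^ p : ℝ≥0) : ℝ≥0∞) * ‖X i ω‖ₑ ^ p
  have hmeasi : ∀ n i, Measurable fun ω => (((q⁻¹ ^ n) ^ p : ℝ≥0) : ℝ≥0∞) * ‖X i ω‖ₑ ^ p :=
    fun n i => ((hX i).enorm.pow_const p).const_mul _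
  have hmeasn : ∀ n, Measurable fun ω =>
      ∑ i ∈ (hfin n).toFinset, (((q⁻¹ ^ n) ^ p : ℝ≥0) : ℝ≥0∞) * ‖X i ω‖ₑ ^ p :=
    fun n => Finset.measurable_sum _ fun i _ => hmeasi n i
  have hf : Measurable f := Measurable.tsum hmeasn
  have hint : ∫⁻ ω, f ω ∂P ≠ ∞ := by
    have hle : ∫⁻ ω, f ω ∂P ≤
        ∑' n, (((A * c) * (M * (2⁻¹ * q⁻¹) ^ p) ^ n : ℝ≥0) : ℝ≥0∞) := by
      rw [lintegral_tsum fun n => (hmeasn n).aemeasurable]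
      refine ENNReal.tsum_le_tsum fun n => ?_
      rw [lintegral_finsetSum _ fun i _ => hmeasi n i]
      calc ∑ i ∈ (hfin n).toFinset, ∫⁻ ω, (((q⁻¹ ^ n) ^ p : ℝ≥0) : ℝ≥0∞) * ‖X i ω‖ₑ ^ p ∂P
          ≤ ∑ i ∈ (hfin n).toFinset,
            (((q⁻¹ ^ n) ^ p * (c * (2⁻¹ ^ n) ^ p) : ℝ≥0) : ℝ≥0∞) := by
            refine Finset.sum_le_sum fun i hi => ?_
            rw [lintegral_const_mul _ ((hX i).enorm.pow_const p)]
            have := hc n i ((hfin n).mem_toFinset.1 hi)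
            rw [ENNReal.coe_mul, ENNReal.coe_mul c]
            gcongr
        _ = (((I n).ncard * ((q⁻¹ ^ n) ^ p * (c * (2⁻¹ ^ n) ^ p)) : ℝ≥0) : ℝ≥0∞) := by
            rw [Finset.sum_const, ← ncard_eq_toFinset_card _ (hfin n), nsmul_eq_mul]
            push_cast
            rfl
        _ ≤ _ := by
            rw [ENNReal.coe_le_coe]
            have h : ((I n).ncard : ℝ≥0) ≤ A * M ^ n := by exact_mod_cast hcard n
            calc _ ≤ (A * M ^ n : ℝ≥0) * ((q⁻¹ ^ n) ^ p * (c * (2⁻¹ ^ n) ^ p)) := by gcongr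
              _ = _ := by
                rw [mul_pow, mul_pow, ← pow_mul, ← pow_mul, mul_pow, ← pow_mul, ← pow_mul,
                  mul_comm n p]
                ring
    refine ne_top_of_le_ne_top ?_ hle
    rw [ENNReal.tsum_coe_ne_top_iff_summable]
    exact (NNReal.summable_geometric hp).mul_left _
  filter_upwards [ae_lt_top hf hint] with ω hω
  refine ⟨1 + (f ω).toReal, by positivity, fun n i hi => ?_⟩
  have hle : (((q⁻¹ ^ n) ^ p : ℝ≥0) : ℝ≥0∞) * ‖X i ω‖ₑ ^ p ≤ f ω :=
    (Finset.single_le_sum (f := fun i => (((q⁻¹ ^ n) ^ p : ℝ≥0) : ℝ≥0∞) * ‖X i ω‖ₑ ^ p)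
      (fun _ _ => zero_le) ((hfin n).mem_toFinset.2 hi)).trans
      (ENNReal.le_tsum (f := fun n => ∑ i ∈ (hfin n).toFinset,
        (((q⁻¹ ^ n) ^ p : ℝ≥0) : ℝ≥0∞) * ‖X i ω‖ₑ ^ p) n)
  have hle' := ENNReal.toReal_mono hω.ne hle
  have hqn : (0 : ℝ) < (q : ℝ) ^ n := by positivity
  have hpow : (|X i ω| / q ^ n) ^ p ≤ (f ω).toReal := by
    refine le_trans (le_of_eq ?_) hle'
    simp [ENNReal.toReal_mul, div_eq_mul_inv, mul_pow, mul_comm]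
  rw [← div_le_iff₀ hqn]
  rcases le_total (|X i ω| / (q : ℝ) ^ n) 1 with h | h
  · exact h.trans (le_add_of_nonneg_right ENNReal.toReal_nonneg)
  · exact ((le_self_pow₀ h (by omega)).trans hpow).trans (le_add_of_nonneg_left zero_le_one)

/-! ### Chaining for separable fields -/

/-- A chaining bound. The relation `U n` says that two indices are close at scale `n`, and `π n`
projects onto a finite net of scale `n`. If increments at scale `n` have `p`-th moments of order
`2 ^ (-n * p)` for all `p`, then almost surely all increments at scale `n` are `O(q ^ n)`, for any
`q ∈ (1 / 2, 1)`. Chaining along the nets gives the bound on the countable set that witnesses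
separability, and separability transfers it to the whole index set. -/
theorem ae_exists_modulus {S : Type*} [TopologicalSpace S] {Z : S → Ω → ℝ}
    (hZ : ∀ s, Measurable (Z s)) (hsep : IsSeparableField P Z)
    {U : ℕ → S → S → Prop}
    (hU : ∀ n s, ∃ E, IsOpen E ∧ s ∈ E ∧ ∀ s' ∈ E, U n s' s)
    {π : ℕ → S → S} (hfin : ∀ n, (range (π n)).Finite) {A M : ℕ}
    (hcard : ∀ n, (range (π n)).ncard ≤ A * M ^ n)
    (hmom : ∀ p : ℕ, ∃ c : ℝ≥0, ∀ n s,
      ∫⁻ ω, ‖Z (π n s) ω - Z s ω‖ₑ ^ p ∂P ≤ c * (((2⁻¹ : ℝ≥0) ^ n) ^ p : ℝ≥0) ∧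
      ∀ s', U n s s' →
        ∫⁻ ω, ‖Z (π n s) ω - Z (π (n + 1) s') ω‖ₑ ^ p ∂P ≤ c * (((2⁻¹ : ℝ≥0) ^ n) ^ p : ℝ≥0))
    {q : ℝ≥0} (hq : 2⁻¹ < q) (hq1 : q < 1) :
    ∀ᵐ ω ∂P, ∃ K : ℝ, 0 ≤ K ∧ ∀ n s s', U n s s' → |Z s ω - Z s' ω| ≤ K * q ^ n := by
  obtain ⟨S₀, hS₀, -, N, -, hN0, hN⟩ := hsep
  have hX : ∀ i : S × S, Measurable fun ω => Z i.1 ω - Z i.2 ω := fun i => (hZ _).sub (hZ _)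
  -- Links of the chains: pairs of net points on consecutive levels.
  have hlinks : ∀ᵐ ω ∂P, ∃ K : ℝ, 0 ≤ K ∧ ∀ n, ∀ i ∈
      {i : S × S | ∃ s s', U n s s' ∧ i = (π n s, π (n + 1) s')},
      |Z i.1 ω - Z i.2 ω| ≤ K * q ^ n := by
    have hsub : ∀ n, {i : S × S | ∃ s s', U n s s' ∧ i = (π n s, π (n + 1) s')} ⊆
        range (π n) ×ˢ range (π (n + 1)) := by
      rintro n _ ⟨s, s', -, rfl⟩
      exact ⟨mem_range_self _, mem_range_self _⟩
    refine ae_exists_forall_abs_le_mul_pow (A := A * A * M) (M := M * M) hX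
      (fun n => ((hfin n).prod (hfin (n + 1))).subset (hsub n)) (fun n => ?_) (fun p => ?_) hq
    · refine (ncard_le_ncard (hsub n) ((hfin n).prod (hfin (n + 1)))).trans ?_
      rw [ncard_prod]
      calc _ ≤ (A * M ^ n) * (A * M ^ (n + 1)) := Nat.mul_le_mul (hcard n) (hcard (n + 1))
        _ = _ := by rw [mul_pow]; ring
    · obtain ⟨c, hc⟩ := hmom p
      refine ⟨c, ?_⟩
      rintro n _ ⟨s, s', h, rfl⟩
      exact (hc n s).2 s' h
  -- Along the countable set `S₀`, the chain `π n s` ends at `s`.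
  have hends : ∀ᵐ ω ∂P, ∀ s ∈ S₀, ∃ K : ℝ, 0 ≤ K ∧ ∀ n, ∀ i ∈ ({(π n s, s)} : Set (S × S)),
      |Z i.1 ω - Z i.2 ω| ≤ K * q ^ n := by
    rw [ae_ball_iff hS₀]
    intro s _
    refine ae_exists_forall_abs_le_mul_pow (A := 1) (M := 1) hX (fun n => finite_singleton _)
      (fun n => by simp) (fun p => ?_) hq
    obtain ⟨c, hc⟩ := hmom p
    refine ⟨c, ?_⟩
    rintro n _ rfl
    exact (hc n s).1
  have hNae : ∀ᵐ ω ∂P, ω ∉ N := measure_eq_zero_iff_ae_notMem.1 hN0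
  filter_upwards [hlinks, hends, hNae] with ω ⟨K, hK0, hK⟩ hω hωN
  have hlink : ∀ n s s', U n s s' → |Z (π n s) ω - Z (π (n + 1) s') ω| ≤ K * q ^ n :=
    fun n s s' h => hK n _ ⟨s, s', h, rfl⟩
  have hrefl : ∀ n s, U n s s := fun n s => by
    obtain ⟨E, -, hs, hE⟩ := hU n s
    exact hE s hs
  have hqr : (q : ℝ) < 1 := by exact_mod_cast hq1
  have hS₀le : ∀ s ∈ S₀, ∀ n, |Z (π n s) ω - Z s ω| ≤ K * q ^ n / (1 - q) := by
    intro s hs n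
    obtain ⟨K', -, hK'⟩ := hω s hs
    have hlim : Tendsto (fun n => Z (π n s) ω) atTop (𝓝 (Z s ω)) := by
      rw [tendsto_iff_dist_tendsto_zero]
      refine squeeze_zero (fun _ => dist_nonneg) (fun n => hK' n _ rfl) ?_
      have := (tendsto_pow_atTop_nhds_zero_of_lt_one q.2 hqr).const_mul K'
      rwa [mul_zero] at this
    exact dist_le_of_le_geometric_of_tendsto (q : ℝ) K hqr
      (fun n => hlink n s s (hrefl n s)) hlim n
  -- On a neighbourhood `E` of `s`, the values of `Z` at points of `S₀` stay in a closed ball around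
  -- `Z (π n s)`; separability puts `Z s` in it as well.
  set L : ℝ := K / (1 - q) + 2 * K with hL
  have hall : ∀ s n, |Z s ω - Z (π n s) ω| ≤ L * q ^ n := by
    intro s n
    obtain ⟨E, hEo, hsE, hE⟩ := hU n s
    have hmem : ω ∈ {ω' | ∀ s' ∈ E ∩ S₀,
        Z s' ω' ∈ Metric.closedBall (Z (π n s) ω) (L * q ^ n)} := by
      rintro s' ⟨hs'E, hs'⟩
      have h1 := abs_le.1 (hS₀le s' hs' n)
      have h2 := abs_le.1 (hlink n s' s (hE s' hs'E))
      have h3 := abs_le.1 (hlink n s s (hrefl n s))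
      have h4 : L * q ^ n = K * q ^ n / (1 - q) + 2 * (K * q ^ n) := by rw [hL]; ring
      rw [Metric.mem_closedBall, Real.dist_eq, abs_le, h4]
      constructor <;> linarith
    have hmem' : ω ∈ {ω' | ∀ s' ∈ E, Z s' ω' ∈ Metric.closedBall (Z (π n s) ω) (L * q ^ n)} := by
      by_contra hcon
      exact hωN (hN E hEo _ Metric.isClosed_closedBall (Or.inr ⟨hmem, hcon⟩))
    exact hmem' s hsE
  have hL0 : 0 ≤ L := by
    have : 0 < 1 - (q : ℝ) := by linarith
    positivity
  refine ⟨2 * L + 2 * K, by positivity, fun n s s' h => ?_⟩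
  have h1 := abs_le.1 (hall s n)
  have h2 := abs_le.1 (hall s' n)
  have h3 := abs_le.1 (hlink n s s' h)
  have h4 := abs_le.1 (hlink n s' s' (hrefl n s'))
  rw [abs_le]
  constructor <;> linarith

/-! ### Gaussian moments -/

/-- The `p`-th absolute moment of a centred Gaussian variable is at most a constant times the
`p`-th power of its standard deviation. -/
theorem exists_lintegral_enorm_pow_le (p : ℕ) :
    ∃ c : ℝ≥0, ∀ X : Ω → ℝ, HasGaussianLaw X P → ∫ ω, X ω ∂P = 0 →
      ∀ σ : ℝ≥0, Var[X; P] ≤ (σ : ℝ) ^ 2 → ∫⁻ ω, ‖X ω‖ₑ ^ p ∂P ≤ c * (σ ^ p : ℝ≥0) := by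
  have hfin : ∫⁻ x, ‖x‖ₑ ^ p ∂(gaussianReal 0 1) ≠ ∞ := by
    rcases Nat.eq_zero_or_pos p with rfl | hp
    · simp
    · have h := (memLp_id_gaussianReal (μ := 0) (v := 1) (p : ℝ≥0)).2
      have h2 := lintegral_rpow_enorm_lt_top_of_eLpNorm_lt_top (by simpa using hp.ne')
        (by simp) h
      simpa using h2.ne
  refine ⟨(∫⁻ x, ‖x‖ₑ ^ p ∂(gaussianReal 0 1)).toNNReal, fun X hX hX0 σ hσ => ?_⟩
  have hmap := hX.map_eq_gaussianReal
  rw [hX0] at hmap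
  set s : ℝ≥0 := NNReal.sqrt Var[X; P].toNNReal with hs
  have hsσ : s ≤ σ := by
    rw [hs, NNReal.sqrt_le_iff_le_sq]
    exact Real.toNNReal_le_iff_le_coe.2 (by exact_mod_cast hσ)
  have hscale : gaussianReal 0 Var[X; P].toNNReal
      = (gaussianReal 0 1).map ((s : ℝ) * ·) := by
    rw [gaussianReal_map_const_mul, mul_zero, mul_one]
    congr 1
    ext
    simp [hs]
  have hm : Measurable fun x : ℝ => ‖x‖ₑ ^ p := by fun_prop
  calc ∫⁻ ω, ‖X ω‖ₑ ^ p ∂P = ∫⁻ x, ‖x‖ₑ ^ p ∂(P.map X) :=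
        (lintegral_map' hm.aemeasurable hX.aemeasurable).symm
    _ = ∫⁻ x, ((s ^ p : ℝ≥0) : ℝ≥0∞) * ‖x‖ₑ ^ p ∂(gaussianReal 0 1) := by
        rw [hmap, hscale, lintegral_map hm (by fun_prop)]
        refine lintegral_congr fun x => ?_
        rw [enorm_mul, mul_pow, ENNReal.coe_pow]
        simp
    _ = ((∫⁻ x, ‖x‖ₑ ^ p ∂(gaussianReal 0 1)).toNNReal : ℝ≥0∞) * (s ^ p : ℝ≥0) := by
        rw [lintegral_const_mul _ hm, ENNReal.coe_toNNReal hfin, mul_comm]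
    _ ≤ _ := by gcongr

/-- The variance of an increment is the squared canonical distance of the covariance kernel. -/
theorem variance_increment_eq {S : Type*} {Z : S → Ω → ℝ} (hgauss : IsGaussianProcess Z P)
    (s s' : S) : Var[Z s - Z s'; P] = canonicalSqDist (covKernel P Z) s s' := by
  have := hgauss.isProbabilityMeasure
  rw [variance_sub (hgauss.hasGaussianLaw_eval s).memLp_two
    (hgauss.hasGaussianLaw_eval s').memLp_two, canonicalSqDist, covKernel, covKernel, covKernel,
    covariance_self (hgauss.aemeasurable s), covariance_self (hgauss.aemeasurable s')]
  ring

/-! ### The normalised exponential -/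

section Normalised

variable {T : Type*} [MeasurableSpace T] {μ : Measure T} [IsFiniteMeasure μ] {g g' : T → ℝ}
  {m h : ℝ}

theorem integrable_exp_of_abs_le (hg : Measurable g) (hm : ∀ t, |g t| ≤ m) :
    Integrable (fun t => Real.exp (g t)) μ := by
  refine Integrable.of_bound (by fun_prop) (Real.exp m) (ae_of_all _ fun t => ?_)
  rw [Real.norm_of_nonneg (Real.exp_pos _).le, Real.exp_le_exp]
  exact (abs_le.1 (hm t)).2

theorem exp_neg_mul_le_integral_exp (hg : Measurable g) (hm : ∀ t, |g t| ≤ m) :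
    Real.exp (-m) * μ.real univ ≤ ∫ t, Real.exp (g t) ∂μ := by
  have := integral_mono (μ := μ) (integrable_const (Real.exp (-m))) (integrable_exp_of_abs_le hg hm)
    fun t => Real.exp_le_exp.2 (abs_le.1 (hm t)).1
  simpa [mul_comm] using this

theorem integral_exp_le_exp_mul (hg : Measurable g) (hm : ∀ t, |g t| ≤ m) :
    ∫ t, Real.exp (g t) ∂μ ≤ Real.exp m * μ.real univ := by
  have := integral_mono (μ := μ) (integrable_exp_of_abs_le hg hm) (integrable_const (Real.exp m))
    fun t => Real.exp_le_exp.2 (abs_le.1 (hm t)).2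
  simpa [mul_comm] using this

theorem abs_exp_sub_exp_le {a b : ℝ} (ha : a ≤ m) (hb : b ≤ m) :
    |Real.exp a - Real.exp b| ≤ Real.exp m * |a - b| := by
  wlog hab : b ≤ a generalizing a b
  · rw [abs_sub_comm, abs_sub_comm a]
    exact this hb ha (le_of_not_ge hab)
  rw [abs_of_nonneg (sub_nonneg.2 (Real.exp_le_exp.2 hab)), abs_of_nonneg (sub_nonneg.2 hab)]
  have h1 : Real.exp b = Real.exp a * Real.exp (b - a) := by rw [← Real.exp_add]; ring_nf
  have h2 := Real.add_one_le_exp (b - a)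
  have h3 : Real.exp a ≤ Real.exp m := Real.exp_le_exp.2 ha
  have h4 := Real.exp_pos a
  calc Real.exp a - Real.exp b = Real.exp a * (1 - Real.exp (b - a)) := by rw [h1]; ring
    _ ≤ Real.exp a * (a - b) := mul_le_mul_of_nonneg_left (by linarith) h4.le
    _ ≤ _ := mul_le_mul_of_nonneg_right h3 (by linarith)

/-- On functions bounded by `m`, normalising the exponential is Lipschitz in the sup norm. -/
theorem abs_exp_div_integral_sub_le (hμ : 0 < μ.real univ) (hg : Measurable g)
    (hg' : Measurable g') (hm : ∀ t, |g t| ≤ m) (hm' : ∀ t, |g' t| ≤ m)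
    (hh : ∀ t, |g t - g' t| ≤ h) (t : T) :
    |Real.exp (g t) / ∫ u, Real.exp (g u) ∂μ - Real.exp (g' t) / ∫ u, Real.exp (g' u) ∂μ| ≤
      2 * Real.exp m ^ 4 / μ.real univ * h := by
  have hI := exp_neg_mul_le_integral_exp (μ := μ) hg hm
  have hI' := exp_neg_mul_le_integral_exp (μ := μ) hg' hm'
  have hIle := integral_exp_le_exp_mul (μ := μ) hg hm
  have hdiff : ∀ u, |Real.exp (g u) - Real.exp (g' u)| ≤ Real.exp m * h := fun u =>
    (abs_exp_sub_exp_le (abs_le.1 (hm u)).2 (abs_le.1 (hm' u)).2).trans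
      (mul_le_mul_of_nonneg_left (hh u) (Real.exp_pos m).le)
  have hII : |(∫ u, Real.exp (g' u) ∂μ) - ∫ u, Real.exp (g u) ∂μ| ≤
      Real.exp m * h * μ.real univ := by
    rw [abs_sub_comm, ← integral_sub (integrable_exp_of_abs_le hg hm)
      (integrable_exp_of_abs_le hg' hm'), ← Real.norm_eq_abs]
    exact norm_integral_le_of_norm_le_const (ae_of_all _ hdiff)
  set V := μ.real univ
  set I := ∫ u, Real.exp (g u) ∂μ
  set I' := ∫ u, Real.exp (g' u) ∂μ
  have hlow : 0 < Real.exp (-m) * V := by positivity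
  have hIpos : 0 < I := hlow.trans_le hI
  have hI'pos : 0 < I' := hlow.trans_le hI'
  have h0 : 0 ≤ h := (abs_nonneg _).trans (hh t)
  have hnum : |Real.exp (g t) * (I' - I) + (Real.exp (g t) - Real.exp (g' t)) * I| ≤
      2 * Real.exp m ^ 2 * h * V := by
    refine (abs_add_le _ _).trans ?_
    rw [abs_mul, abs_mul, Real.abs_exp, abs_of_pos hIpos]
    have h1 : Real.exp (g t) * |I' - I| ≤ Real.exp m * (Real.exp m * h * V) := by
      gcongr
      exact (abs_le.1 (hm t)).2
    have h2 : |Real.exp (g t) - Real.exp (g' t)| * I ≤ Real.exp m * h * (Real.exp m * V) := by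
      gcongr
      exact hdiff t
    calc _ ≤ _ := add_le_add h1 h2
      _ = _ := by ring
  have heq : Real.exp (g t) / I - Real.exp (g' t) / I' =
      (Real.exp (g t) * (I' - I) + (Real.exp (g t) - Real.exp (g' t)) * I) / (I * I') := by
    field_simp
    ring
  rw [heq, abs_div, abs_of_pos (mul_pos hIpos hI'pos)]
  calc _ ≤ 2 * Real.exp m ^ 2 * h * V / ((Real.exp (-m) * V) * (Real.exp (-m) * V)) := by gcongr
    _ = _ := by
      rw [Real.exp_neg]
      field_simp

end Normalised

theorem isFiniteMeasure_lebesgueOn {d : ℕ} {T : Set (Fin d → ℝ)} (hT : IsCompact T) :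
    IsFiniteMeasure (lebesgueOn T) := by
  refine ⟨?_⟩
  rw [lebesgueOn, comap_subtype_coe_apply hT.measurableSet, image_univ, Subtype.range_coe]
  exact hT.measure_lt_top

theorem real_lebesgueOn_univ_pos {d : ℕ} {T : Set (Fin d → ℝ)} (hT : IsCompact T)
    (hTpos : 0 < volume T) : 0 < (lebesgueOn T).real univ := by
  rw [Measure.real, lebesgueOn, comap_subtype_coe_apply hT.measurableSet, image_univ,
    Subtype.range_coe]
  exact ENNReal.toReal_pos hTpos.ne' hT.measure_lt_top.ne

theorem isPositivePdf_of_abs_le {d : ℕ} {T : Set (Fin d → ℝ)} (hT : IsCompact T)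
    (hTpos : 0 < volume T) {g : T → ℝ} {m : ℝ} (hg : Measurable g) (hm : ∀ t, |g t| ≤ m) :
    IsPositivePdf fun t => Real.exp (g t) / ∫ u, Real.exp (g u) ∂(lebesgueOn T) := by
  have := isFiniteMeasure_lebesgueOn hT
  have hV := real_lebesgueOn_univ_pos hT hTpos
  have hI : 0 < ∫ u, Real.exp (g u) ∂(lebesgueOn T) :=
    (by positivity : 0 < Real.exp (-m) * (lebesgueOn T).real univ).trans_le
      (exp_neg_mul_le_integral_exp hg hm)
  refine ⟨by fun_prop, fun t => div_pos (Real.exp_pos _) hI, ?_⟩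
  rw [← ofReal_integral_eq_lintegral_ofReal ((integrable_exp_of_abs_le hg hm).div_const _)
    (ae_of_all _ fun t => (div_pos (Real.exp_pos _) hI).le), integral_div, div_self hI.ne',
    ENNReal.ofReal_one]

/-! ### Sample path regularity of the Gaussian field -/

/-- Two points of `D × T` are close at scale `n` if their coordinates differ by at most `R₁ * r₁ ^ n`
and `R₂ * r₂ ^ n`. -/
def IsCloseAt {dD dT : ℕ} {D : Set (Fin dD → ℝ)} {T : Set (Fin dT → ℝ)} (R₁ r₁ R₂ r₂ : ℝ) (n : ℕ)
    (s s' : D × T) : Prop :=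
  ‖(s.1 : Fin dD → ℝ) - s'.1‖ ≤ R₁ * r₁ ^ n ∧ ‖(s.2 : Fin dT → ℝ) - s'.2‖ ≤ R₂ * r₂ ^ n

namespace IsCloseAt

variable {dD dT : ℕ} {D : Set (Fin dD → ℝ)} {T : Set (Fin dT → ℝ)} {R₁ r₁ R₂ r₂ : ℝ} {n : ℕ}
  {a b c e : D × T}

theorem refl (h₁ : 0 ≤ R₁ * r₁ ^ n) (h₂ : 0 ≤ R₂ * r₂ ^ n) : IsCloseAt R₁ r₁ R₂ r₂ n a a :=
  ⟨by simpa using h₁, by simpa using h₂⟩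

theorem of_succ (hR₁ : 0 < R₁) (hR₂ : 0 < R₂) (hr₁ : 0 < r₁) (hr₂ : 0 < r₂) (hr₁1 : r₁ < 1)
    (hr₂1 : r₂ < 1) (h : IsCloseAt R₁ r₁ R₂ r₂ (n + 1) a b) : IsCloseAt R₁ r₁ R₂ r₂ n a b :=
  ⟨h.1.trans (mul_le_mul_of_nonneg_left (pow_le_pow_of_le_one hr₁.le hr₁1.le n.le_succ) hR₁.le),
    h.2.trans (mul_le_mul_of_nonneg_left (pow_le_pow_of_le_one hr₂.le hr₂1.le n.le_succ) hR₂.le)⟩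

/-- Chains of three steps at scale `n` stay close at scale `n` with tripled constants. This is the
form needed for `a` and `e` net points of `b` and `c`. -/
theorem trans₃ (hba : IsCloseAt R₁ r₁ R₂ r₂ n b a) (hbc : IsCloseAt R₁ r₁ R₂ r₂ n b c)
    (hce : IsCloseAt R₁ r₁ R₂ r₂ n c e) : IsCloseAt (3 * R₁) r₁ (3 * R₂) r₂ n a e := by
  have htri : ∀ {d : ℕ} (a b c e : Fin d → ℝ) {R ρ : ℝ}, ‖b - a‖ ≤ R * ρ → ‖b - c‖ ≤ R * ρ →
      ‖c - e‖ ≤ R * ρ → ‖a - e‖ ≤ 3 * R * ρ := by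
    intro d a b c e R ρ h1 h2 h3
    have : a - e = -(b - a) + (b - c) + (c - e) := by abel
    rw [this]
    have := norm_add₃_le (a := -(b - a)) (b := b - c) (c := c - e)
    rw [norm_neg] at this
    linarith
  exact ⟨htri _ _ _ _ hba.1 hbc.1 hce.1, htri _ _ _ _ hba.2 hbc.2 hce.2⟩

end IsCloseAt

/-- Moments of increments at scale `n`. When `r₁ ^ α₁ = r₂ ^ α₂ = 1 / 4`, the kernel condition makes
their standard deviation of order `2 ^ (-n)`. -/
theorem exists_lintegral_enorm_increment_pow_le {Ω : Type*} [MeasurableSpace Ω] {P : Measure Ω}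
    {dD dT : ℕ} {D : Set (Fin dD → ℝ)} {T : Set (Fin dT → ℝ)}
    {Z : D × T → Ω → ℝ} (hgauss : IsGaussianProcess Z P) (hcentred : IsCentredField P Z)
    {C α₁ α₂ : ℝ} (hC : 0 < C) (hα₁ : 0 < α₁) (hα₂ : 0 < α₂)
    (hk : KernelHolderCondition (covKernel P Z) C α₁ α₂)
    {R₁ r₁ R₂ r₂ : ℝ} (hR₁ : 0 < R₁) (hr₁ : 0 < r₁) (hr₁α : r₁ ^ α₁ = 1 / 4)
    (hR₂ : 0 < R₂) (hr₂ : 0 < r₂) (hr₂α : r₂ ^ α₂ = 1 / 4) (p : ℕ) :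
    ∃ c : ℝ≥0, ∀ n (s s' : D × T), IsCloseAt R₁ r₁ R₂ r₂ n s s' →
      ∫⁻ ω, ‖Z s ω - Z s' ω‖ₑ ^ p ∂P ≤ c * (((2⁻¹ : ℝ≥0) ^ n) ^ p : ℝ≥0) := by
  obtain ⟨σ, hσ⟩ : ∃ σ : ℝ≥0, ∀ n (s s' : D × T),
      IsCloseAt R₁ r₁ R₂ r₂ n s s' →
        Var[Z s - Z s'; P] ≤ ((σ * 2⁻¹ ^ n : ℝ≥0) : ℝ) ^ 2 := by
    refine ⟨NNReal.sqrt (C * max (R₁ ^ α₁) (R₂ ^ α₂)).toNNReal, ?_⟩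
    rintro n s s' ⟨h1, h2⟩
    have hscale : ∀ {a R r α : ℝ}, 0 < R → 0 < r → 0 < α → r ^ α = 1 / 4 → 0 ≤ a →
        a ≤ R * r ^ n → a ^ α ≤ R ^ α * (1 / 4) ^ n := by
      intro a R r α hR hr hα hrα ha h
      calc a ^ α ≤ (R * r ^ n) ^ α := Real.rpow_le_rpow ha h hα.le
        _ = R ^ α * (1 / 4) ^ n := by
          rw [Real.mul_rpow hR.le (by positivity), ← hrα, ← Real.rpow_natCast, ← Real.rpow_natCast,
            ← Real.rpow_mul hr.le, ← Real.rpow_mul hr.le, mul_comm α]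
    have h1' := hscale (by positivity) hr₁ hα₁ hr₁α (norm_nonneg _) h1
    have h2' := hscale (by positivity) hr₂ hα₂ hr₂α (norm_nonneg _) h2
    rw [variance_increment_eq hgauss]
    refine (hk s.1 s'.1 s.2 s'.2).trans ?_
    have hsq : ((NNReal.sqrt (C * max (R₁ ^ α₁) (R₂ ^ α₂)).toNNReal : ℝ≥0) : ℝ) ^ 2
        = C * max (R₁ ^ α₁) (R₂ ^ α₂) := by
      rw [← NNReal.coe_pow, NNReal.sq_sqrt, Real.coe_toNNReal _ (by positivity)]
    rw [NNReal.coe_mul, mul_pow, hsq, mul_assoc]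
    have hhalf : (((2⁻¹ : ℝ≥0) ^ n : ℝ≥0) : ℝ) ^ 2 = (1 / 4) ^ n := by
      push_cast
      rw [← pow_mul, mul_comm n, pow_mul]
      norm_num
    rw [hhalf, max_mul_of_nonneg _ _ (by positivity)]
    exact mul_le_mul_of_nonneg_left (max_le_max h1' h2') hC.le
  obtain ⟨c, hc⟩ := exists_lintegral_enorm_pow_le (P := P) p
  refine ⟨c * σ ^ p, fun n s s' h => ?_⟩
  have h0 : ∫ ω, (Z s - Z s') ω ∂P = 0 := by
    simp only [Pi.sub_apply]
    rw [integral_sub (hgauss.hasGaussianLaw_eval s).integrable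
      (hgauss.hasGaussianLaw_eval s').integrable, hcentred, hcentred, sub_zero]
  refine (hc _ hgauss.hasGaussianLaw_sub h0 _ (hσ n s s' h)).trans (le_of_eq ?_)
  rw [mul_pow]
  push_cast
  ring

/-- The modulus of continuity of the Gaussian field. The scales `r₁` and `r₂` are chosen so that
`r₁ ^ α₁ = r₂ ^ α₂ = 1 / 4`, so increments at scale `n` have standard deviation of order `2 ^ (-n)`.
Scale `0` contains all pairs. -/
theorem ae_exists_modulus_of_kernelHolderCondition {Ω : Type*} [MeasurableSpace Ω] {P : Measure Ω}
    {dD dT : ℕ} {D : Set (Fin dD → ℝ)} (hD : IsCompact D) {T : Set (Fin dT → ℝ)} (hT : IsCompact T)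
    {Z : D × T → Ω → ℝ} (hZ : ∀ s, Measurable (Z s)) (hsep : IsSeparableField P Z)
    (hgauss : IsGaussianProcess Z P) (hcentred : IsCentredField P Z)
    {C α₁ α₂ : ℝ} (hC : 0 < C) (hα₁ : 0 < α₁) (hα₂ : 0 < α₂)
    (hk : KernelHolderCondition (covKernel P Z) C α₁ α₂) :
    ∃ R₁ R₂ r₂ : ℝ, 0 < R₁ ∧ 0 < R₂ ∧ 0 < r₂ ∧
      (∀ s s' : D × T, IsCloseAt R₁ ((1 / 4) ^ α₁⁻¹) R₂ r₂ 0 s s') ∧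
      ∀ᵐ ω ∂P, ∀ q : ℚ, 1 / 2 < (q : ℝ) → (q : ℝ) < 1 → ∃ K : ℝ, 0 ≤ K ∧
        ∀ n s s', IsCloseAt R₁ ((1 / 4) ^ α₁⁻¹) R₂ r₂ n s s' →
          |Z s ω - Z s' ω| ≤ K * (q : ℝ) ^ n := by
  have hr : ∀ α : ℝ, 0 < α → 0 < (1 / 4 : ℝ) ^ α⁻¹ ∧ (1 / 4 : ℝ) ^ α⁻¹ < 1 ∧
      ((1 / 4 : ℝ) ^ α⁻¹) ^ α = 1 / 4 := fun α hα =>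
    ⟨by positivity, Real.rpow_lt_one (by norm_num) (by norm_num) (by positivity),
      Real.rpow_inv_rpow (by norm_num) hα.ne'⟩
  obtain ⟨hr₁, hr₁1, hr₁α⟩ := hr α₁ hα₁
  obtain ⟨hr₂, hr₂1, hr₂α⟩ := hr α₂ hα₂
  set r₁ : ℝ := (1 / 4 : ℝ) ^ α₁⁻¹
  set r₂ : ℝ := (1 / 4 : ℝ) ^ α₂⁻¹
  obtain ⟨R₁, hR₁, hdiam₁, A₁, M₁, π₁, hπ₁⟩ := exists_nets hD.isBounded hr₁
  obtain ⟨R₂, hR₂, hdiam₂, A₂, M₂, π₂, hπ₂⟩ := exists_nets hT.isBounded hr₂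
  refine ⟨R₁, R₂, r₂, hR₁, hR₂, hr₂, fun s s' => ?_, ?_⟩
  · exact ⟨by simpa using hdiam₁ s.1 s'.1, by simpa using hdiam₂ s.2 s'.2⟩
  have hnet : ∀ n s, IsCloseAt R₁ r₁ R₂ r₂ n s (π₁ n s.1, π₂ n s.2) := fun n s =>
    ⟨(hπ₁ n).1 s.1, (hπ₂ n).1 s.2⟩
  rw [ae_all_iff]
  intro q
  by_cases hq : 1 / 2 < (q : ℝ) ∧ (q : ℝ) < 1
  swap
  · exact ae_of_all _ fun ω h1 h2 => absurd ⟨h1, h2⟩ hq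
  obtain ⟨q', hq'⟩ : ∃ q' : ℝ≥0, (q' : ℝ) = q :=
    ⟨(q : ℝ).toNNReal, Real.coe_toNNReal _ (by linarith [hq.1])⟩
  rw [← hq'] at hq ⊢
  have key := ae_exists_modulus hZ hsep (U := IsCloseAt R₁ r₁ R₂ r₂)
    (π := fun n s => (π₁ n s.1, π₂ n s.2)) (A := A₁ * A₂) (M := M₁ * M₂) (q := q')
    ?_ ?_ ?_ ?_ ?_ ?_
  · filter_upwards [key] with ω hω _ _
    exact hω
  · intro n s
    have hcont₁ : Continuous fun s' : D × T => ‖(s'.1 : Fin dD → ℝ) - s.1‖ := by fun_prop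
    have hcont₂ : Continuous fun s' : D × T => ‖(s'.2 : Fin dT → ℝ) - s.2‖ := by fun_prop
    refine ⟨{s' | ‖(s'.1 : Fin dD → ℝ) - s.1‖ < R₁ * r₁ ^ n} ∩
        {s' | ‖(s'.2 : Fin dT → ℝ) - s.2‖ < R₂ * r₂ ^ n},
      (isOpen_lt hcont₁ continuous_const).inter (isOpen_lt hcont₂ continuous_const),
      ?_, fun s' hs' => ⟨hs'.1.le, hs'.2.le⟩⟩
    constructor
    · simp only [mem_ofPred_eq, sub_self, norm_zero]
      positivity
    · simp only [mem_ofPred_eq, sub_self, norm_zero]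
      positivity
  · intro n
    refine (((hπ₁ n).2.1).prod ((hπ₂ n).2.1)).subset ?_
    rintro _ ⟨s, rfl⟩
    exact ⟨mem_range_self _, mem_range_self _⟩
  · intro n
    have hsub : range (fun s : D × T => (π₁ n s.1, π₂ n s.2)) ⊆
        range (π₁ n) ×ˢ range (π₂ n) := by
      rintro _ ⟨s, rfl⟩
      exact ⟨mem_range_self _, mem_range_self _⟩
    refine (ncard_le_ncard hsub (((hπ₁ n).2.1).prod ((hπ₂ n).2.1))).trans ?_
    rw [ncard_prod]
    calc _ ≤ (A₁ * M₁ ^ n) * (A₂ * M₂ ^ n) := Nat.mul_le_mul (hπ₁ n).2.2 (hπ₂ n).2.2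
      _ = _ := by rw [mul_pow]; ring
  · intro p
    obtain ⟨c, hc⟩ := exists_lintegral_enorm_increment_pow_le hgauss hcentred hC hα₁ hα₂ hk
      (by positivity : 0 < 3 * R₁) hr₁ hr₁α (by positivity : 0 < 3 * R₂) hr₂ hr₂α p
    have hrefl : ∀ n (s : D × T), IsCloseAt R₁ r₁ R₂ r₂ n s s := fun n s =>
      IsCloseAt.refl (by positivity) (by positivity)
    exact ⟨c, fun n s => ⟨hc n _ _ ((hnet n s).trans₃ (hrefl n s) (hrefl n s)), fun s' h =>
      hc n _ _ ((hnet n s).trans₃ h ((hnet (n + 1) s').of_succ hR₁ hR₂ hr₁ hr₂ hr₁1 hr₂1))⟩⟩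
  · rw [← NNReal.coe_lt_coe]
    simpa using hq.1
  · rw [← NNReal.coe_lt_coe]
    simpa using hq.2

/-- A bound that decays geometrically in the scale is a Hölder bound: `q ≤ r ^ β` turns `q ^ n`
into `(r ^ n) ^ β`. -/
theorem exists_le_mul_rpow_of_scales {R r q K β : ℝ} (hR : 0 < R) (hr : 0 < r) (hr1 : r < 1)
    (hq : 0 ≤ q) (hβ : 0 ≤ β) (hqβ : q ≤ r ^ β) (hK : 0 ≤ K) {δ : ℝ} (hδ : 0 < δ) (hδR : δ ≤ R) :
    ∃ n : ℕ, δ ≤ R * r ^ n ∧ K * q ^ n ≤ K / (R * r) ^ β * δ ^ β := by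
  obtain ⟨n, hn1, hn2⟩ := exists_nat_pow_near_of_lt_one (div_pos hδ hR)
    ((div_le_one hR).2 hδR) hr hr1
  rw [lt_div_iff₀ hR] at hn1
  rw [div_le_iff₀ hR] at hn2
  refine ⟨n, by linarith, ?_⟩
  rw [div_mul_eq_mul_div, le_div_iff₀ (by positivity), mul_assoc]
  refine mul_le_mul_of_nonneg_left ?_ hK
  calc q ^ n * (R * r) ^ β ≤ (r ^ β) ^ n * (R * r) ^ β := by gcongr
    _ = (r ^ n * (R * r)) ^ β := by
      rw [← Real.rpow_natCast, ← Real.rpow_mul hr.le, mul_comm β, Real.rpow_mul hr.le,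
        Real.rpow_natCast, Real.mul_rpow (x := r ^ n) (by positivity) (by positivity)]
    _ ≤ δ ^ β := by
      refine Real.rpow_le_rpow (by positivity) ?_ hβ
      calc r ^ n * (R * r) = r ^ (n + 1) * R := by ring
        _ ≤ δ := hn1.le

/-! ### Hölder continuity of the normalised field -/

/-- Hölder continuity into `UniformFun T ℝ` for the sup distance, from a real-valued bound that is
uniform in `t`. -/
theorem holderWith_ofFun {d : ℕ} {D : Set (Fin d → ℝ)} {T : Type*} {Y : D → T → ℝ} {K β : ℝ≥0}
    (h : ∀ x x' t, x ≠ x' → |Y x t - Y x' t| ≤ K * ‖(x : Fin d → ℝ) - x'‖ ^ (β : ℝ)) :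
    HolderWith K β fun x => UniformFun.ofFun (Y x) := by
  intro x x'
  rcases eq_or_ne x x' with rfl | hne
  · simp
  rw [UniformFun.edist_le]
  intro t
  rw [edist_dist, edist_dist, ENNReal.ofReal_rpow_of_nonneg dist_nonneg β.coe_nonneg,
    ← ENNReal.ofReal_coe_nnreal, ← ENNReal.ofReal_mul K.coe_nonneg]
  refine ENNReal.ofReal_le_ofReal ?_
  rw [Subtype.dist_eq, dist_eq_norm]
  exact h x x' t hne

end SLGP

/-- The metric of the function space `UniformFun T ℝ` is the sup distance
`⨆ t, |f t - g t|` (with values in `[0, ∞]`). -/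
theorem mainTheorem2 {Ω : Type*} [MeasurableSpace Ω] (P : Measure Ω) [IsProbabilityMeasure P]
    (dD dT : ℕ) (hdD : 1 ≤ dD) (hdT : 1 ≤ dT)
    (D : Set (Fin dD → ℝ)) (hD : IsCompact D) (hDconv : Convex ℝ D)
    (T : Set (Fin dT → ℝ)) (hT : IsCompact T) (hTconv : Convex ℝ T) (hTpos : 0 < volume T)
    (Z : D × T → Ω → ℝ)
    (hmeas : SLGP.IsMeasurableField Z)
    (hsep : SLGP.IsSeparableField P Z)
    (hgauss : IsGaussianProcess Z P)
    (hcentred : SLGP.IsCentredField P Z)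
    (C α₁ α₂ : ℝ) (hC : 0 < C) (hα₁ : 0 < α₁) (hα₂ : 0 < α₂)
    (hk : SLGP.KernelHolderCondition (SLGP.covKernel P Z) C α₁ α₂) :
    (∀ᵐ ω ∂P, ∀ x : D,
      Integrable (fun u : T => Real.exp (Z (x, u) ω)) (SLGP.lebesgueOn T) ∧
        SLGP.IsPositivePdf (SLGP.inducedSLGP Z ω x)) ∧
    (∀ᵐ ω ∂P, ∀ β : ℝ≥0, 0 < β → (β : ℝ) < α₁ / 2 →
      ∃ K : ℝ≥0, HolderWith K β fun x : D => UniformFun.ofFun (SLGP.inducedSLGP Z ω x)) := by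

  have hZ : ∀ s, Measurable (Z s) := fun s => hmeas.comp measurable_prodMk_left
  have := SLGP.isFiniteMeasure_lebesgueOn hT
  have hV := SLGP.real_lebesgueOn_univ_pos hT hTpos
  obtain ⟨R₁, R₂, r₂, hR₁, hR₂, hr₂, hclose, hmod⟩ :=
    SLGP.ae_exists_modulus_of_kernelHolderCondition hD hT hZ hsep hgauss hcentred hC hα₁ hα₂ hk
  have hsec : ∀ (ω : Ω) (x : D), Measurable fun t : T => Z (x, t) ω := fun ω x =>
    hmeas.comp ((measurable_prodMk_left (x := x)).prodMk measurable_const)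
  -- All pairs are close at scale `0`, so the modulus bounds the sample paths.
  have hbdd : ∀ᵐ ω ∂P, ∃ m : ℝ, ∀ s, |Z s ω| ≤ m := by
    filter_upwards [hmod] with ω hω
    obtain ⟨K, -, hK⟩ := hω (3 / 4) (by norm_num) (by norm_num)
    rcases isEmpty_or_nonempty (D × T) with hemp | ⟨⟨s₀⟩⟩
    · exact ⟨0, fun s => (hemp.false s).elim⟩
    refine ⟨|Z s₀ ω| + K, fun s => ?_⟩
    have h1 := hK 0 s s₀ (hclose s s₀)
    have h2 := abs_sub_abs_le_abs_sub (Z s ω) (Z s₀ ω)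
    rw [pow_zero, mul_one] at h1
    linarith
  constructor
  · filter_upwards [hbdd] with ω ⟨m, hm⟩ x
    exact ⟨SLGP.integrable_exp_of_abs_le (hsec ω x) fun t => hm (x, t),
      SLGP.isPositivePdf_of_abs_le hT hTpos (hsec ω x) fun t => hm (x, t)⟩
  · filter_upwards [hbdd, hmod] with ω ⟨m, hm⟩ hω β hβ0 hβ
    set r₁ : ℝ := (1 / 4 : ℝ) ^ α₁⁻¹ with hr₁def
    have hr₁ : 0 < r₁ := by positivity
    have hr₁1 : r₁ < 1 := Real.rpow_lt_one (by norm_num) (by norm_num) (by positivity)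
    -- `r₁ ^ (α₁ / 2) = 1 / 2`, so `β < α₁ / 2` leaves room for a rational `q` below `r₁ ^ β`.
    have hhalf : 1 / 2 < r₁ ^ (β : ℝ) := by
      have h1 : r₁ ^ (α₁ / 2) = 1 / 2 := by
        rw [hr₁def, ← Real.rpow_mul (by norm_num), show α₁⁻¹ * (α₁ / 2) = 1 / 2 by field_simp,
          ← Real.sqrt_eq_rpow, Real.sqrt_eq_iff_mul_self_eq (by norm_num) (by norm_num)]
        norm_num
      rw [← h1]
      exact Real.rpow_lt_rpow_of_exponent_gt hr₁ hr₁1 hβ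
    obtain ⟨q, hq1, hq2⟩ := exists_rat_btwn hhalf
    have hqlt : (q : ℝ) < 1 :=
      hq2.trans (Real.rpow_lt_one hr₁.le hr₁1 (by exact_mod_cast hβ0))
    obtain ⟨K, hK0, hK⟩ := hω q hq1 hqlt
    have hL0 : 0 ≤ 2 * Real.exp m ^ 4 / (SLGP.lebesgueOn T).real Set.univ *
        (K / (R₁ * r₁) ^ (β : ℝ)) := by positivity
    refine ⟨.mk _ hL0, SLGP.holderWith_ofFun fun x x' t hne => ?_⟩
    have hδ : 0 < ‖(x : Fin dD → ℝ) - x'‖ := by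
      rw [norm_pos_iff, sub_ne_zero]
      exact fun h => hne (Subtype.ext h)
    have hδR : ‖(x : Fin dD → ℝ) - x'‖ ≤ R₁ := by simpa using (hclose (x, t) (x', t)).1
    obtain ⟨n, hn, hle⟩ := SLGP.exists_le_mul_rpow_of_scales hR₁ hr₁ hr₁1
      (by linarith : (0 : ℝ) ≤ q) β.2 hq2.le hK0 hδ hδR
    have hincr : ∀ u : T, |Z (x, u) ω - Z (x', u) ω| ≤
        K / (R₁ * r₁) ^ (β : ℝ) * ‖(x : Fin dD → ℝ) - x'‖ ^ (β : ℝ) := fun u =>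
      (hK n (x, u) (x', u) ⟨hn, by simpa using (by positivity : 0 ≤ R₂ * r₂ ^ n)⟩).trans hle
    have := SLGP.abs_exp_div_integral_sub_le hV (hsec ω x) (hsec ω x') (fun u => hm (x, u))
      (fun u => hm (x', u)) hincr t
    rw [← mul_assoc] at this
    exact this
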